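/- Let $Z$ be a positive random variable, let $U$ be independent of $Z$ and uniformly distributed on the unit circle of $\mathbb{R}^2$, let $m\in\mathbb{R}^2$, and let $A_0$ be a real $2\times 2$ matrix such that $\Sigma=A_0A_0^\top$ has full rank and is diagonal. Let $F$ be the distribution of $(X,Y)=(s(X'),r(Y'))$, where $(X',Y')^\top\stackrel{d}{=} m+ZA_0U$ and $s,r:\mathbb{R}\to\mathbb{R}$ are increasing functions; that is, $F$ is parallel meta-elliptical with generating variable $Z$. Assume that the distribution function of $F$ is continuous, and denote its marginal distribution functions by $F_1,F_2$. Suppose that there exist $\nu>0$, $\beta<0$ and a function $A$ with $A(t)\to 0$ as $t\to\infty$, of constant (nonzero) sign near infinity, such that for every $x>0$ $$\lim_{t\to\infty}\frac{\mathbb{P}(Z>tx)/\mathbb{P}(Z>t)-x^{-\nu}}{A(t)}=x^{-\nu}\,\frac{x^{\beta}-1}{\beta}.$$ Then the limit $$R(x,y)=\lim_{t\downarrow 0}t^{-1}\mathbb{P}\{1-F_1(X)\le tx,\ 1-F_2(Y)\le ty\}$$ exists for all $(x,y)\in[0,\infty)^2$, and for every $\alpha\in(0,-\beta/\nu)$,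 $$t^{-1}\mathbb{P}\{1-F_1(X)\le tx,\ 1-F_2(Y)\le ty\}-R(x,y)=O(t^{\alpha})\qquad (t\downarrow 0),$$ uniformly on $\{(x,y): x+y=1,\ x\ge 0,\ y\ge 0\}$. -/

import Mathlib

open MeasureTheory ProbabilityTheory Filter Topology Set

noncomputable section

/-- The uniform distribution on the unit circle of `ℝ²`: the law of `(cos Θ, sin Θ)` for an
angle `Θ` that is uniform on `(0, 2π]`. -/
def uniformCircle : Measure (Fin 2 → ℝ) :=
  (ProbabilityTheory.cond (volume : Measure ℝ) (Ioc 0 (2 * Real.pi))).map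
    (fun θ => ![Real.cos θ, Real.sin θ])

/-- The law of `m + Z • A U`, where `Z` has law `ζ` and `U` is independent of `Z` and uniform on
the unit circle. -/
def ellipticalLaw (ζ : Measure ℝ) (m : Fin 2 → ℝ) (A : Matrix (Fin 2) (Fin 2) ℝ) :
    Measure (Fin 2 → ℝ) :=
  (ζ.prod uniformCircle).map (fun p => m + p.1 • A.mulVec p.2)

/-- `G` is a parallel elliptical law whose generating variable has law `ζ`: it is the law of
`m + Z • A U` where `Σ = A Aᵀ` has full rank and vanishing off-diagonal entries (`ρ = 0`). -/
def IsParallelElliptical (G : Measure (Fin 2 → ℝ)) (ζ : Measure ℝ) : Prop :=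
  ∃ (m : Fin 2 → ℝ) (A : Matrix (Fin 2) (Fin 2) ℝ),
    (A * A.transpose).det ≠ 0 ∧ (A * A.transpose) 0 1 = 0 ∧ G = ellipticalLaw ζ m A

/-- `F` is a parallel meta-elliptical law whose generating variable has law `ζ`: it is the law
of `(s X, r Y)` with `(X, Y)` parallel elliptical and `s`, `r` increasing. -/
def IsParallelMetaElliptical (F : Measure (ℝ × ℝ)) (ζ : Measure ℝ) : Prop :=
  ∃ G : Measure (Fin 2 → ℝ), IsParallelElliptical G ζ ∧
    ∃ s r : ℝ → ℝ, Monotone s ∧ Monotone r ∧ F = G.map (fun w => (s (w 0), r (w 1)))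

/-- `t⁻¹ P(1 - F₁(X) ≤ t x, 1 - F₂(Y) ≤ t y)` for `(X, Y)` with law `F` and marginal
distribution functions `F₁`, `F₂`. -/
def tailRatio (F : Measure (ℝ × ℝ)) (t x y : ℝ) : ℝ :=
  t⁻¹ * F.real {p : ℝ × ℝ | 1 - cdf F.fst p.1 ≤ t * x ∧ 1 - cdf F.snd p.2 ≤ t * y}

/-- `R` is the limit function on `[0, ∞)²` of the tail ratio of `F`. -/
def IsTailLimit (F : Measure (ℝ × ℝ)) (R : ℝ → ℝ → ℝ) : Prop :=
  ∀ x y : ℝ, 0 ≤ x → 0 ≤ y → Tendsto (fun t => tailRatio F t x y) (𝓝[>] 0) (𝓝 (R x y))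

/-- The second-order condition with exponent `α`: the tail ratio differs from `R` by `O(t ^ α)`
as `t ↓ 0`, uniformly on the unit simplex. -/
def SecondOrderCondition (F : Measure (ℝ × ℝ)) (R : ℝ → ℝ → ℝ) (α : ℝ) : Prop :=
  ∃ C : ℝ, ∀ᶠ t : ℝ in 𝓝[>] 0, ∀ x y : ℝ, 0 ≤ x → 0 ≤ y → x + y = 1 →
    |tailRatio F t x y - R x y| ≤ C * t ^ α

end

/-! In polar form the coordinates are `s (m 0 + Z V)` and `r (m 1 + Z W)`, where `V`, `W` are
nonzero linear forms in the cosine and sine of a uniform angle `Θ` independent of `Z`. Marginal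
quantile exceedances are invariant under monotone maps, so `m`, `s`, `r` drop out and only `(Z V, Z
W)` matters.

A negative second-order index forces `P(Z > t) = c t^(-ν) + O(t^(-ν-δ))` for every `0 < δ < -β`
(`exists_pareto_expansion`). Integrating over the angle, `P(Z f(Θ) > 1) = c E[f^ν] + O(B^(ν+δ))`
whenever `0 ≤ f ≤ B` (`abs_measureReal_prod_sub_le`). With `f = p V₊` this expands the marginal
tail; inverted, the level `u` corresponds to some `p` with `c E[V₊^ν] p^ν = u + O(u^(1+δ/ν))`
(`exists_marginal_quantile`). With `f = min (p V₊) (p' W₊)` it expands the joint tail.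

Substituting the levels `u = t x`, `u' = t y` gives the limit `R(x, y) = E[min (x V₊^ν / E[V₊^ν]) (y
W₊^ν / E[W₊^ν])]` (`abs_joint_sub_productTailLimit_le`). Since `R` is homogeneous of degree one,
dividing by `t` with `δ = α ν` leaves an error `O(t^α)`. -/

/-! ### From second-order regular variation to a Pareto expansion. -/

/-- A function that is bounded near infinity and decreases by a factor `2 ^ (-δ)` under doubling
of the argument is `O(t ^ (-δ))`. -/
theorem exists_abs_le_rpow_neg_of_doubling {f : ℝ → ℝ} {δ : ℝ} (hδ : 0 < δ)
    (hb : ∀ᶠ t in atTop, |f t| ≤ 1)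
    (hf : ∀ᶠ t in atTop, |f (2 * t)| ≤ (2 : ℝ) ^ (-δ) * |f t|) :
    ∃ C, 0 < C ∧ ∀ᶠ t in atTop, |f t| ≤ C * t ^ (-δ) := by
  obtain ⟨t₀, ht₀⟩ := eventually_atTop.1 (hb.and (hf.and (eventually_ge_atTop (1 : ℝ))))
  have h1 : 1 ≤ t₀ := (ht₀ t₀ le_rfl).2.2
  have hpos : 0 < t₀ := by linarith
  -- Induction over dyadic blocks. On the first one `t ≤ 2 * t₀` makes the right side at least `1`,
  -- which dictates the constant.
  have key : ∀ n : ℕ, ∀ t, t₀ ≤ t → t ≤ 2 ^ (n + 1) * t₀ →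
      |f t| ≤ (2 * t₀) ^ δ * t ^ (-δ) := by
    intro n
    induction n with
    | zero =>
      intro t h h'
      have htpos : 0 < t := by linarith
      refine (ht₀ t h).1.trans ?_
      rw [Real.rpow_neg htpos.le, ← div_eq_mul_inv, one_le_div (by positivity)]
      exact Real.rpow_le_rpow htpos.le (by simpa using h') hδ.le
    | succ n ih =>
      intro t h h'
      by_cases hc : t ≤ 2 ^ (n + 1) * t₀
      · exact ih t h hc
      push Not at hc
      have hp : (2 : ℝ) ≤ 2 ^ (n + 1) := by
        have : (1 : ℝ) ≤ 2 ^ n := one_le_pow₀ (by norm_num)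
        rw [pow_succ]; linarith
      have ht2 : t₀ ≤ t / 2 := by nlinarith
      have h2 : t / 2 ≤ 2 ^ (n + 1) * t₀ := by
        rw [pow_succ] at h'; linarith
      have e := (ht₀ (t / 2) ht2).2.1
      rw [mul_div_cancel₀ t (two_ne_zero)] at e
      calc |f t| ≤ 2 ^ (-δ) * |f (t / 2)| := e
        _ ≤ 2 ^ (-δ) * ((2 * t₀) ^ δ * (t / 2) ^ (-δ)) := by
            gcongr; exact ih _ ht2 h2
        _ = (2 * t₀) ^ δ * (2 ^ (-δ) * (t / 2) ^ (-δ)) := by ring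
        _ = _ := by
            rw [← Real.mul_rpow (by norm_num) (by linarith), mul_div_cancel₀ t (two_ne_zero)]
  refine ⟨(2 * t₀) ^ δ, by positivity, ?_⟩
  filter_upwards [eventually_ge_atTop t₀] with t ht
  obtain ⟨n, hn⟩ := pow_unbounded_of_one_lt (t / t₀) (one_lt_two (α := ℝ))
  refine key n t ht ?_
  rw [div_lt_iff₀ hpos] at hn
  have : (0 : ℝ) < 2 ^ n := by positivity
  rw [pow_succ]; nlinarith

/-- If the increments of `l` under doubling are `O(t ^ (-δ))` and its multiplicative increments
vanish at infinity, then `l` converges at the rate `t ^ (-δ)`. -/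
theorem exists_abs_sub_le_rpow_neg_of_increments {l : ℝ → ℝ} {δ C : ℝ} (hδ : 0 < δ)
    (hl : ∀ᶠ t in atTop, |l (2 * t) - l t| ≤ C * t ^ (-δ))
    (hlim : ∀ x : ℝ, 0 < x → Tendsto (fun t => l (t * x) - l t) atTop (𝓝 0)) :
    ∃ L D, ∀ᶠ t in atTop, |l t - L| ≤ D * t ^ (-δ) := by
  obtain ⟨t₀, ht₀⟩ := eventually_atTop.1 (hl.and (eventually_ge_atTop (1 : ℝ)))
  have h1 : 1 ≤ t₀ := (ht₀ t₀ le_rfl).2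
  have hpos : 0 < t₀ := by linarith
  set r : ℝ := 2 ^ (-δ) with hr
  have hr1 : r < 1 := Real.rpow_lt_one_of_one_lt_of_neg (by norm_num) (by linarith)
  -- Along `2 ^ n * t` the increments are geometric with ratio `r`; summing them gives both
  -- convergence and the rate.
  have hstep : ∀ t, t₀ ≤ t → ∀ n : ℕ,
      dist (l (2 ^ n * t)) (l (2 ^ (n + 1) * t)) ≤ (C * t ^ (-δ)) * r ^ n := by
    intro t ht n
    have hp : (1 : ℝ) ≤ 2 ^ n := one_le_pow₀ (by norm_num)
    have := (ht₀ (2 ^ n * t) (by nlinarith)).1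
    rw [dist_comm, Real.dist_eq, pow_succ, mul_comm (2 ^ n : ℝ) 2, mul_assoc]
    refine this.trans_eq ?_
    rw [Real.mul_rpow (by positivity) (by linarith), hr, ← Real.rpow_natCast,
      ← Real.rpow_natCast, ← Real.rpow_mul (by norm_num), ← Real.rpow_mul (by norm_num),
      mul_comm (n : ℝ)]
    ring
  have hex : ∀ t, t₀ ≤ t → ∃ L, Tendsto (fun n : ℕ => l (2 ^ n * t)) atTop (𝓝 L) := fun t ht =>
    cauchySeq_tendsto_of_complete (cauchySeq_of_le_geometric r _ hr1 (hstep t ht))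
  obtain ⟨L, hL⟩ := hex t₀ le_rfl
  -- The limit does not depend on the starting point: the orbits of `t` and `t₀` differ by the fixed
  -- factor `t / t₀`, so `hlim` applies.
  have hL' : ∀ t, t₀ ≤ t → Tendsto (fun n : ℕ => l (2 ^ n * t)) atTop (𝓝 L) := by
    intro t ht
    have hx : 0 < t / t₀ := div_pos (by linarith) hpos
    have hinf : Tendsto (fun n : ℕ => (2 : ℝ) ^ n * t₀) atTop atTop :=
      (tendsto_pow_atTop_atTop_of_one_lt one_lt_two).atTop_mul_const hpos
    have := ((hlim _ hx).comp hinf).add hL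
    rw [zero_add] at this
    refine this.congr fun n => ?_
    simp only [Function.comp]
    rw [mul_assoc, mul_div_cancel₀ t hpos.ne']
    ring
  refine ⟨L, C / (1 - r), ?_⟩
  filter_upwards [eventually_ge_atTop t₀] with t ht
  have := dist_le_of_le_geometric_of_tendsto₀ r _ hr1 (hstep t ht) (hL' t ht)
  rw [pow_zero, one_mul, Real.dist_eq] at this
  exact this.trans_eq (by ring)

/-- Near infinity, a function satisfying a second-order condition of regular variation does not
vanish. -/
theorem eventually_ne_zero_of_secondOrder {H A : ℝ → ℝ} {ν β : ℝ}
    (hA : Tendsto A atTop (𝓝 0)) (hA0 : ∀ᶠ t in atTop, A t ≠ 0)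
    (hH : ∀ x : ℝ, 0 < x → Tendsto (fun t : ℝ => (H (t * x) / H t - x ^ (-ν)) / A t)
        atTop (𝓝 (x ^ (-ν) * ((x ^ β - 1) / β)))) :
    ∀ᶠ t in atTop, H t ≠ 0 := by
  have h1 := hH 1 one_pos
  simp only [mul_one, Real.one_rpow, sub_self, zero_div, mul_zero] at h1
  have h2 := (h1.abs).eventually_lt_const (u := 1) (by simp)
  have h3 := (hA.abs).eventually_lt_const (u := 1) (by simp)
  -- Since `0 / 0 = 0`, a zero of `H` would turn the quotient at `x = 1` into `-1 / A t`, of modulus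
  -- greater than `1`, although the limit there is `0`.
  filter_upwards [h2, h3, hA0] with t h2 h3 h4 h5
  rw [h5] at h2
  simp only [div_zero, zero_sub, abs_div, abs_neg, abs_one] at h2
  rw [div_lt_one (abs_pos.2 h4)] at h2
  linarith

/-- Multiplying by `t ^ ν` removes the first-order factor and leaves a function of index zero, whose
logarithm can be summed along doublings. -/
theorem tendsto_normalized_of_secondOrder {H A : ℝ → ℝ} {ν β : ℝ}
    (hH : ∀ x : ℝ, 0 < x → Tendsto (fun t : ℝ => (H (t * x) / H t - x ^ (-ν)) / A t)
        atTop (𝓝 (x ^ (-ν) * ((x ^ β - 1) / β)))) {x : ℝ} (hx : 0 < x) :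
    Tendsto (fun t : ℝ => (((t * x) ^ ν * H (t * x)) / (t ^ ν * H t) - 1) / A t)
        atTop (𝓝 ((x ^ β - 1) / β)) := by
  have h := (hH x hx).const_mul (x ^ ν)
  have e : x ^ ν * x ^ (-ν) = 1 := by rw [← Real.rpow_add hx]; simp
  rw [← mul_assoc, e, one_mul] at h
  refine h.congr' ?_
  filter_upwards [eventually_gt_atTop 0] with t ht
  have ht' : 0 < t ^ ν := by positivity
  rw [← mul_div_assoc, mul_sub, e, Real.mul_rpow ht.le hx.le,
    mul_assoc, mul_div_mul_left _ _ ht'.ne', mul_div_assoc]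

/-- The auxiliary function of a second-order condition with index `β` is `O(t ^ (-δ))` for every
`δ < -β`. -/
theorem exists_abs_auxiliary_le {g A : ℝ → ℝ} {β δ : ℝ} (hβ : β < 0) (hδ : 0 < δ)
    (hδβ : δ < -β) (hA : Tendsto A atTop (𝓝 0)) (hA0 : ∀ᶠ t in atTop, A t ≠ 0)
    (hg0 : ∀ᶠ t in atTop, 0 < g t)
    (hg : ∀ x : ℝ, 0 < x → Tendsto (fun t : ℝ => (g (t * x) / g t - 1) / A t)
        atTop (𝓝 ((x ^ β - 1) / β)))
    (hg1 : ∀ x : ℝ, 0 < x → Tendsto (fun t : ℝ => g (t * x) / g t) atTop (𝓝 1)) :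
    ∃ C, 0 < C ∧ ∀ᶠ t in atTop, |A t| ≤ C * t ^ (-δ) := by
  have h2 : Tendsto (fun t : ℝ => t * 2) atTop atTop := tendsto_id.atTop_mul_const two_pos
  set k : ℝ → ℝ := fun x => (x ^ β - 1) / β with hk
  have h2β : (2 : ℝ) ^ β < 1 := Real.rpow_lt_one_of_one_lt_of_neg (by norm_num) hβ
  have hk2 : k 2 ≠ 0 := by
    simp only [hk]; exact div_ne_zero (by linarith) hβ.ne
  have hk4 : (k 4 - 1 * k 2) / k 2 = 2 ^ β := by
    have h4 : (4 : ℝ) ^ β = 2 ^ β * 2 ^ β := by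
      rw [← Real.mul_rpow] <;> norm_num
    have : (2 : ℝ) ^ β - 1 ≠ 0 := by linarith
    have hβ' := hβ.ne
    simp only [hk, h4]
    field_simp
    ring
  -- Write `g(4t)/g(2t) - 1 = (g(4t)/g(t) - 1) - (g(4t)/g(2t)) (g(2t)/g(t) - 1)`. Dividing the right
  -- side by `A t` and the left side by `A (2t)` isolates `A (2t) / A t`, with limit `(k 4 - k 2) /
  -- k 2`.
  have hA2 : Tendsto (fun t => A (t * 2) / A t) atTop (𝓝 (2 ^ β)) := by
    have hq2 : Tendsto (fun t => (g (t * 2 * 2) / g (t * 2) - 1) / A (t * 2)) atTop (𝓝 (k 2)) :=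
      (hg 2 two_pos).comp h2
    have hr2 : Tendsto (fun t => g (t * 2 * 2) / g (t * 2)) atTop (𝓝 1) :=
      (hg1 2 two_pos).comp h2
    have := ((hg 4 (by norm_num)).sub (hr2.mul (hg 2 two_pos))).div hq2 hk2
    rw [hk4] at this
    refine this.congr' ?_
    have hq0 := hq2.eventually_ne hk2
    filter_upwards [hA0, h2.eventually hA0, hg0, h2.eventually hg0, hq0] with t a b c d e
    have e4 : t * 4 = t * 2 * 2 := by ring
    rw [Pi.div_apply, div_eq_iff e, e4]
    have hc := c.ne'
    have hd := d.ne'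
    field_simp
    ring
  refine exists_abs_le_rpow_neg_of_doubling hδ ?_ ?_
  · exact (hA.abs).eventually_le_const (by simp)
  · have hlt : |(2 : ℝ) ^ β| < 2 ^ (-δ) := by
      rw [abs_of_pos (by positivity)]
      exact Real.rpow_lt_rpow_of_exponent_lt (by norm_num) (by linarith)
    filter_upwards [(hA2.abs).eventually_le_const hlt, hA0] with t h h0
    rwa [abs_div, div_le_iff₀ (abs_pos.2 h0), mul_comm t] at h

/-- Second-order regular variation with a negative second-order index implies a Pareto-type
expansion of the tail. -/
theorem exists_pareto_expansion {H A : ℝ → ℝ} {ν β δ : ℝ} (hν : 0 < ν) (hβ : β < 0) (hδ : 0 < δ)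
    (hδβ : δ < -β) (hH0 : ∀ t, 0 ≤ H t) (hH1 : ∀ t, H t ≤ 1)
    (hA : Tendsto A atTop (𝓝 0)) (hA0 : ∀ᶠ t in atTop, A t ≠ 0)
    (hH : ∀ x : ℝ, 0 < x → Tendsto (fun t : ℝ => (H (t * x) / H t - x ^ (-ν)) / A t)
        atTop (𝓝 (x ^ (-ν) * ((x ^ β - 1) / β)))) :
    ∃ c C, 0 < c ∧ 0 < C ∧ ∀ t, 0 < t → |H t - c * t ^ (-ν)| ≤ C * t ^ (-(ν + δ)) := by
  set g : ℝ → ℝ := fun t => t ^ ν * H t with hgdef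
  have hg0 : ∀ᶠ t in atTop, 0 < g t := by
    filter_upwards [eventually_ne_zero_of_secondOrder hA hA0 hH, eventually_gt_atTop 0]
      with t h ht
    exact mul_pos (by positivity) (lt_of_le_of_ne (hH0 t) h.symm)
  have hg : ∀ x : ℝ, 0 < x → Tendsto (fun t : ℝ => (g (t * x) / g t - 1) / A t)
      atTop (𝓝 ((x ^ β - 1) / β)) := fun x hx => tendsto_normalized_of_secondOrder hH hx
  have hg1 : ∀ x : ℝ, 0 < x → Tendsto (fun t : ℝ => g (t * x) / g t) atTop (𝓝 1) := by
    intro x hx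
    have := ((hg x hx).mul hA).add_const 1
    rw [mul_zero, zero_add] at this
    refine this.congr' ?_
    filter_upwards [hA0] with t h
    rw [div_mul_cancel₀ _ h, sub_add_cancel]
  obtain ⟨C₁, hC₁, hAle⟩ := exists_abs_auxiliary_le hβ hδ hδβ hA hA0 hg0 hg hg1
  have hlog : ∀ x : ℝ, 0 < x → ∀ᶠ t in atTop,
      Real.log (g (t * x)) - Real.log (g t) = Real.log (g (t * x) / g t) := by
    intro x hx
    filter_upwards [hg0, (tendsto_id.atTop_mul_const hx).eventually hg0] with t a b
    exact (Real.log_div (ne_of_gt b) a.ne').symm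
  -- The doubling increment of `log g` is at most `2 * |q - 1|` with `q = g(2t)/g(t)` close to `1`,
  -- hence `O(A t)`. The leading constant is then `c = exp L`.
  obtain ⟨L, D, hLD⟩ : ∃ L D, ∀ᶠ t in atTop, |Real.log (g t) - L| ≤ D * t ^ (-δ) := by
    refine exists_abs_sub_le_rpow_neg_of_increments (C := 2 * (|((2 : ℝ) ^ β - 1) / β| + 1) * C₁)
      hδ ?_ ?_
    · have hb := ((hg 2 two_pos).abs).eventually_le_const (lt_add_one _)
      have hs := (((hg1 2 two_pos).sub_const 1).abs).eventually_le_const (u := 1 / 2) (by simp)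
      filter_upwards [hb, hs, hlog 2 two_pos, hAle, hA0] with t hb hs hl ha h0
      rw [mul_comm 2 t, hl]
      set q := g (t * 2) / g t
      have hq : 1 / 2 ≤ q := by have := (abs_le.1 hs).1; linarith
      have hq0 : 0 < q := by linarith
      have h1 : |Real.log q| ≤ 2 * |q - 1| := by
        rw [abs_le]
        constructor
        · have := Real.one_sub_inv_le_log_of_pos hq0
          refine le_trans ?_ this
          have e : 1 - q⁻¹ = (q - 1) * q⁻¹ := by field_simp
          have hi : q⁻¹ ≤ 2 := by
            rw [inv_le_comm₀ hq0 two_pos]; linarith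
          have hi0 : 0 < q⁻¹ := by positivity
          rw [e]
          nlinarith [neg_abs_le (q - 1), abs_nonneg (q - 1)]
        · have := Real.log_le_sub_one_of_pos hq0
          linarith [le_abs_self (q - 1), abs_nonneg (q - 1)]
      rw [abs_div, div_le_iff₀ (abs_pos.2 h0)] at hb
      calc |Real.log q| ≤ 2 * |q - 1| := h1
        _ ≤ 2 * ((|((2 : ℝ) ^ β - 1) / β| + 1) * |A t|) := by gcongr
        _ ≤ 2 * ((|((2 : ℝ) ^ β - 1) / β| + 1) * (C₁ * t ^ (-δ))) := by gcongr
        _ = _ := by ring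
    · intro x hx
      have := (hg1 x hx).log one_ne_zero
      rw [Real.log_one] at this
      refine this.congr' ?_
      filter_upwards [hlog x hx] with t h
      exact h.symm
  have hD0 : Tendsto (fun t : ℝ => D * t ^ (-δ)) atTop (𝓝 0) := by
    simpa using (tendsto_rpow_neg_atTop hδ).const_mul D
  have hev : ∀ᶠ t in atTop, |H t - Real.exp L * t ^ (-ν)| ≤
      (Real.exp L * (2 * |D|)) * t ^ (-(ν + δ)) := by
    filter_upwards [hLD, hD0.eventually_le_const one_pos, hg0, eventually_gt_atTop 0]
      with t h1 h2 h3 h4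
    have he : H t = Real.exp L * t ^ (-ν) * Real.exp (Real.log (g t) - L) := by
      rw [Real.exp_sub, Real.exp_log h3, hgdef]
      have := Real.exp_pos L
      rw [Real.rpow_neg h4.le]
      field_simp
    have e2 : H t - Real.exp L * t ^ (-ν) =
        Real.exp L * t ^ (-ν) * (Real.exp (Real.log (g t) - L) - 1) := by
      rw [he]; ring
    rw [e2, abs_mul, abs_of_pos (by positivity), neg_add, Real.rpow_add h4]
    have := Real.abs_exp_sub_one_le (h1.trans h2)
    have h5 : D * t ^ (-δ) ≤ |D| * t ^ (-δ) := by gcongr; exact le_abs_self D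
    calc _ ≤ Real.exp L * t ^ (-ν) * (2 * (|D| * t ^ (-δ))) := by
          gcongr; linarith
      _ = _ := by ring
  -- Below `t₁` both `H ≤ 1` and the main term are dominated by a multiple of `t ^ (-(ν + δ))`. A
  -- bound valid for all `t > 0` lets the angle be integrated out without truncation.
  obtain ⟨t₁, ht₁⟩ := eventually_atTop.1 (hev.and (eventually_gt_atTop (0 : ℝ)))
  have ht₁0 : 0 < t₁ := (ht₁ t₁ le_rfl).2
  refine ⟨Real.exp L, Real.exp L * (2 * |D|) + (t₁ ^ (ν + δ) + Real.exp L * t₁ ^ δ),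
    Real.exp_pos L, by positivity, fun t ht => ?_⟩
  rw [add_mul]
  rcases le_total t₁ t with h | h
  · refine (ht₁ t h).1.trans (le_add_of_nonneg_right (by positivity))
  · refine le_trans ?_ (le_add_of_nonneg_left (by positivity))
    have a1 : 1 ≤ t₁ ^ (ν + δ) * t ^ (-(ν + δ)) := by
      rw [Real.rpow_neg ht.le, ← div_eq_mul_inv, one_le_div (by positivity)]
      exact Real.rpow_le_rpow ht.le h (by positivity)
    have a2 : 1 ≤ t₁ ^ δ * t ^ (-δ) := by
      rw [Real.rpow_neg ht.le, ← div_eq_mul_inv, one_le_div (by positivity)]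
      exact Real.rpow_le_rpow ht.le h (by positivity)
    have a3 : Real.exp L * t ^ (-ν) ≤ Real.exp L * t₁ ^ δ * t ^ (-(ν + δ)) := by
      rw [neg_add, Real.rpow_add ht]
      have : 0 < Real.exp L * t ^ (-ν) := by positivity
      nlinarith
    have a4 : 0 < Real.exp L * t ^ (-ν) := by positivity
    rw [abs_le, add_mul]
    constructor <;> linarith [hH0 t, hH1 t]

/-! ### Inverting a power expansion at the origin. -/

section Quantile

/-- Inversion of an expansion `G p = κ p ^ ν + O(p ^ (ν + δ))` at the origin. -/
theorem exists_inverse_expansion {G : ℝ → ℝ} {κ C ν δ : ℝ} (hκ : 0 < κ) (hC : 0 < C)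
    (hν : 0 < ν) (hδ : 0 < δ) (hG : ContinuousOn G (Ioi 0))
    (hexp : ∀ p, 0 < p → |G p - κ * p ^ ν| ≤ C * p ^ (ν + δ)) :
    ∃ u₀ K, 0 < u₀ ∧ 0 < K ∧ ∀ u, 0 < u → u ≤ u₀ → ∃ p, 0 < p ∧ G p = u ∧
      |κ * p ^ ν - u| ≤ K * u ^ (1 + δ / ν) ∧ p ^ (ν + δ) ≤ K * u ^ (1 + δ / ν) := by
  -- Up to `p₁` the remainder `C * p ^ (ν + δ)` is at most half of the main term.
  set p₁ : ℝ := (κ / (2 * C)) ^ δ⁻¹ with hp₁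
  have hp₁0 : 0 < p₁ := by positivity
  have hlow : ∀ p, 0 < p → p ≤ p₁ → κ / 2 * p ^ ν ≤ G p := by
    intro p h0 h1
    have h2 : p ^ δ ≤ κ / (2 * C) := by
      refine (Real.rpow_le_rpow h0.le h1 hδ.le).trans_eq ?_
      rw [hp₁, ← Real.rpow_mul (by positivity), inv_mul_cancel₀ hδ.ne', Real.rpow_one]
    rw [le_div_iff₀ (by positivity)] at h2
    have h3 := (abs_le.1 (hexp p h0)).1
    rw [Real.rpow_add h0] at h3
    have : 0 < p ^ ν := by positivity
    nlinarith
  have hlim : Tendsto G (𝓝[>] 0) (𝓝 0) := by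
    have hr : ∀ a : ℝ, 0 < a → Tendsto (fun p : ℝ => p ^ a) (𝓝[>] 0) (𝓝 0) := by
      intro a ha
      have := (Real.continuousAt_rpow_const 0 a (Or.inr ha.le)).tendsto
      rw [Real.zero_rpow ha.ne'] at this
      exact this.mono_left nhdsWithin_le_nhds
    have h1 := (hr ν hν).const_mul κ
    have h2 := (hr (ν + δ) (by positivity)).const_mul C
    rw [mul_zero] at h1 h2
    have h3 : Tendsto (fun p => G p - κ * p ^ ν) (𝓝[>] 0) (𝓝 0) := by
      refine squeeze_zero_norm' ?_ h2
      filter_upwards [self_mem_nhdsWithin] with p hp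
      exact hexp p hp
    simpa using h3.add h1
  have hu₀ : 0 < G p₁ := lt_of_lt_of_le (by positivity) (hlow p₁ hp₁0 le_rfl)
  refine ⟨G p₁, (C + 1) * (2 / κ) ^ (1 + δ / ν), hu₀, by positivity, fun u hu hu1 => ?_⟩
  obtain ⟨p', hp'u, hp'0, hp'1⟩ : ∃ p', G p' ≤ u ∧ 0 < p' ∧ p' ≤ p₁ := by
    have e1 := hlim.eventually_le_const hu
    have e2 : ∀ᶠ p in 𝓝[>] (0 : ℝ), p ∈ Ioc 0 p₁ := Ioc_mem_nhdsGT hp₁0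
    obtain ⟨p, hp⟩ := (e1.and e2).exists
    exact ⟨p, hp.1, hp.2.1, hp.2.2⟩
  -- Continuity alone supplies a `p` attaining the level; `hlow` then bounds `p ^ ν` by a multiple
  -- of `u`.
  obtain ⟨p, hp, hpu⟩ := intermediate_value_Icc hp'1
    (hG.mono fun x hx => lt_of_lt_of_le hp'0 hx.1) ⟨hp'u, hu1⟩
  have hp0 : 0 < p := lt_of_lt_of_le hp'0 hp.1
  have hbd : p ^ (ν + δ) ≤ (2 / κ) ^ (1 + δ / ν) * u ^ (1 + δ / ν) := by
    have h1 := hlow p hp0 hp.2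
    rw [hpu] at h1
    have h2 : p ^ ν ≤ 2 / κ * u := by
      rw [div_mul_eq_mul_div, le_div_iff₀ hκ]; linarith
    have e : p ^ (ν + δ) = (p ^ ν) ^ (1 + δ / ν) := by
      rw [← Real.rpow_mul hp0.le]
      congr 1
      field_simp
    rw [e, ← Real.mul_rpow (by positivity) hu.le]
    exact Real.rpow_le_rpow (by positivity) h2 (by positivity)
  have hpos : 0 ≤ (2 / κ) ^ (1 + δ / ν) * u ^ (1 + δ / ν) := by positivity
  refine ⟨p, hp0, hpu, ?_, ?_⟩
  · rw [abs_sub_comm, ← hpu]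
    refine (hexp p hp0).trans ?_
    rw [hpu]
    calc C * p ^ (ν + δ) ≤ C * ((2 / κ) ^ (1 + δ / ν) * u ^ (1 + δ / ν)) := by gcongr
      _ ≤ _ := by nlinarith
  · nlinarith

end Quantile

/-! ### Atomless margins and the probability integral transform. -/

section NullSingletons

theorem continuous_cdf_of_nullSingletons (m : Measure ℝ) [IsProbabilityMeasure m]
    [NullSingletonClass m] :
    Continuous (cdf m) := by
  rw [continuous_iff_continuousAt]
  intro x
  rw [(monotone_cdf m).continuousAt_iff_leftLim_eq_rightLim, StieltjesFunction.rightLim_eq]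
  have h := (cdf m).measure_singleton x
  rw [measure_cdf, measure_singleton] at h
  have h1 := ENNReal.ofReal_eq_zero.1 h.symm
  have h2 := (monotone_cdf m).leftLim_le (le_refl x)
  linarith

/-- One half of the probability integral transform. -/
theorem measureReal_one_sub_cdf_le (m : Measure ℝ) [IsProbabilityMeasure m]
    [NullSingletonClass m] {u : ℝ} (hu : 0 ≤ u) : m.real {x | 1 - cdf m x ≤ u} ≤ u := by
  set S : Set ℝ := {x | 1 - cdf m x ≤ u} with hS
  have hclosed : IsClosed S :=
    isClosed_le (continuous_const.sub (continuous_cdf_of_nullSingletons m)) continuous_const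
  rcases S.eq_empty_or_nonempty with he | hne
  · rw [he]; simpa using hu
  -- If bounded below, `S` lies in the closed half-line starting at its infimum, which it contains.
  -- Otherwise `1 - cdf ≤ u` everywhere, and the limit at `-∞` forces `1 ≤ u`.
  by_cases hb : BddBelow S
  · have hmem : sInf S ∈ S := hclosed.csInf_mem hne hb
    have hsub : S ⊆ Ici (sInf S) := fun x hx => csInf_le hb hx
    have h1 : m.real S ≤ m.real (Ici (sInf S)) := measureReal_mono hsub
    have h2 : m.real (Ici (sInf S)) = m.real (Ioi (sInf S)) :=
      measureReal_congr Ioi_ae_eq_Ici.symm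
    have h3 : m.real (Ioi (sInf S)) = 1 - cdf m (sInf S) := by
      rw [← compl_Iic, probReal_compl_eq_one_sub measurableSet_Iic, cdf_eq_real]
    rw [h2, h3] at h1
    exact h1.trans hmem
  · have hall : ∀ x, 1 - cdf m x ≤ u := by
      intro x
      rw [not_bddBelow_iff] at hb
      obtain ⟨y, hy, hyx⟩ := hb x
      have := monotone_cdf m hyx.le
      have hy' : 1 - cdf m y ≤ u := hy
      linarith
    have h1 : (1 : ℝ) ≤ u := by
      have := (tendsto_cdf_atBot m).const_sub 1
      rw [sub_zero] at this
      exact le_of_tendsto' this hall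
    exact measureReal_le_one.trans h1

/-- A law on the plane with continuous distribution function does not charge vertical lines. -/
theorem nullSingletons_fst_of_continuous {F : Measure (ℝ × ℝ)} [IsProbabilityMeasure F]
    (h : Continuous fun p : ℝ × ℝ => F.real (Iic p)) : NullSingletonClass F.fst := by
  refine ⟨fun x => ?_⟩
  rw [Measure.fst_apply (measurableSet_singleton x)]
  have hU : Prod.fst ⁻¹' {x} ⊆ ⋃ n : ℕ, ({x} ×ˢ Iic (n : ℝ) : Set (ℝ × ℝ)) := by
    rintro ⟨a, b⟩ hab
    obtain ⟨n, hn⟩ := exists_nat_ge b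
    exact mem_iUnion.2 ⟨n, hab, hn⟩
  refine measure_mono_null hU (measure_iUnion_null fun n => ?_)
  rw [← measureReal_eq_zero_iff]
  -- The half-line `{x} × (-∞, n]` has mass at most `F(x, n) - F(a, n)` for every `a < x`; let `a`
  -- increase to `x`.
  have hc : Tendsto (fun a : ℝ => F.real (Iic (x, (n : ℝ))) - F.real (Iic (a, (n : ℝ)))) (𝓝[<] x)
      (𝓝 (F.real (Iic (x, (n : ℝ))) - F.real (Iic (x, (n : ℝ))))) := by
    refine Tendsto.const_sub _ ?_
    have : Continuous fun a : ℝ => F.real (Iic (a, (n : ℝ))) :=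
      h.comp (by fun_prop : Continuous fun a : ℝ => (a, (n : ℝ)))
    exact this.continuousAt.tendsto.mono_left nhdsWithin_le_nhds
  rw [sub_self] at hc
  refine le_antisymm (ge_of_tendsto hc ?_) measureReal_nonneg
  filter_upwards [self_mem_nhdsWithin] with a ha
  have hax : a < x := ha
  have hsub : Iic (a, (n : ℝ)) ⊆ Iic (x, (n : ℝ)) := Iic_subset_Iic.2 ⟨hax.le, le_rfl⟩
  rw [← measureReal_sdiff hsub measurableSet_Iic]
  refine measureReal_mono ?_
  rintro ⟨c, d⟩ ⟨hc', hd⟩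
  have hcx : c = x := hc'
  subst hcx
  exact ⟨⟨le_rfl, hd⟩, fun h' => absurd h'.1 (not_le.2 hax)⟩

theorem nullSingletons_snd_of_continuous {F : Measure (ℝ × ℝ)} [IsProbabilityMeasure F]
    (h : Continuous fun p : ℝ × ℝ => F.real (Iic p)) : NullSingletonClass F.snd := by
  have : IsProbabilityMeasure (F.map Prod.swap) :=
    Measure.isProbabilityMeasure_map measurable_swap.aemeasurable
  rw [← Measure.fst_map_swap]
  refine nullSingletons_fst_of_continuous ?_
  refine (h.comp continuous_swap).congr fun p => ?_
  rw [map_measureReal_apply measurable_swap measurableSet_Iic]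
  refine congrArg F.real (Set.ext fun q => ?_)
  simp [Prod.le_def, and_comm]

end NullSingletons

/-! ### Tails of products of `Z` with functions of an independent variable. -/

section Mixture

variable {T : Type*}

/-- The tail event `{Z V > 1 / p}`, written in a form that is linear in `p`. -/
def scaledTail (V : T → ℝ) (p : ℝ) : Set (ℝ × T) := {q | 1 < q.1 * (p * max (V q.2) 0)}

theorem lt_of_mem_scaledTail {V : T → ℝ} {p : ℝ} (hp : 0 < p) {q : ℝ × T}
    (hq : q ∈ scaledTail V p) : p⁻¹ < q.1 * V q.2 := by
  have h1 : 1 < q.1 * (p * max (V q.2) 0) := hq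
  have hV : 0 < V q.2 := by
    by_contra hcon
    rw [max_eq_right (not_lt.1 hcon)] at h1
    norm_num at h1
  rw [max_eq_left hV.le] at h1
  rw [inv_lt_iff_one_lt_mul₀ hp]
  linarith

theorem mem_scaledTail_iff {V : T → ℝ} {p : ℝ} (hp : 0 < p) {q : ℝ × T} (hq : 0 < q.1) :
    q ∈ scaledTail V p ↔ p⁻¹ < q.1 * V q.2 := by
  refine ⟨lt_of_mem_scaledTail hp, fun h => ?_⟩
  have hV : 0 < V q.2 := by
    have : 0 < q.1 * V q.2 := (inv_pos.2 hp).trans h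
    exact (pos_iff_pos_of_mul_pos this).1 hq
  show 1 < q.1 * (p * max (V q.2) 0)
  rw [max_eq_left hV.le]
  rw [inv_lt_iff_one_lt_mul₀ hp] at h
  linarith

variable [MeasurableSpace T]

theorem measurableSet_scaledTail {V : T → ℝ} (hV : Measurable V) (p : ℝ) :
    MeasurableSet (scaledTail V p) := by
  unfold scaledTail
  exact measurableSet_lt measurable_const (by fun_prop)

variable {ζ : Measure ℝ} {τ : Measure T}

theorem ae_fst_pos (hζ : ∀ᵐ z ∂ζ, 0 < z) : ∀ᵐ q ∂(ζ.prod τ), 0 < q.1 :=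
  Measure.quasiMeasurePreserving_fst.ae hζ

/-- Given `Z = z > 0`, the product equals `w` only on the null set `V = w / z`; the law of `Z`
itself may have atoms. -/
theorem nullSingletons_map_mul [SFinite τ] {V : T → ℝ} (hV : Measurable V) (hζ : ∀ᵐ z ∂ζ, 0 < z)
    (hatom : ∀ v, τ {θ | V θ = v} = 0) :
    NullSingletonClass ((ζ.prod τ).map fun q => q.1 * V q.2) := by
  have hm : Measurable fun q : ℝ × T => q.1 * V q.2 := by fun_prop
  refine ⟨fun w => ?_⟩
  rw [Measure.map_apply hm (measurableSet_singleton w),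
    Measure.measure_prod_null (hm (measurableSet_singleton w))]
  filter_upwards [hζ] with z hz
  refine measure_mono_null (fun θ hθ => ?_) (hatom (w / z))
  have : z * V θ = w := hθ
  simp only [mem_ofPred_eq]
  rw [← this]
  field_simp

theorem scaledTail_ae_eq {V : T → ℝ} (hζ : ∀ᵐ z ∂ζ, 0 < z) {p : ℝ} (hp : 0 < p) :
    scaledTail V p =ᵐ[ζ.prod τ] (fun q : ℝ × T => q.1 * V q.2) ⁻¹' (Ioi p⁻¹) := by
  filter_upwards [ae_fst_pos (τ := τ) hζ] with q hq
  exact propext (mem_scaledTail_iff hp hq)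

/-- Because `Z > 0`, two simultaneous exceedances are one exceedance by the minimum. This reduces
the bivariate tail to a univariate one. -/
theorem scaledTail_inter_ae_eq {V W : T → ℝ} (hζ : ∀ᵐ z ∂ζ, 0 < z) (p p' : ℝ) :
    (scaledTail V p ∩ scaledTail W p' : Set (ℝ × T)) =ᵐ[ζ.prod τ]
      {q : ℝ × T | 1 < q.1 * min (p * max (V q.2) 0) (p' * max (W q.2) 0)} := by
  refine eventuallyEq_set.2 ?_
  filter_upwards [ae_fst_pos (τ := τ) hζ] with q hq
  rw [mem_inter_iff, mul_min_of_nonneg _ _ hq.le, lt_min_iff]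
  exact Iff.rfl

/-- The expansion at `t = 1 / y`. At `y = 0` everything vanishes, so factors that are not bounded
away from zero are allowed. -/
theorem abs_measureReal_one_lt_mul_sub_le {ν δ c C : ℝ} (hν : 0 < ν) (hδ : 0 < δ)
    (hexp : ∀ t, 0 < t → |ζ.real (Ioi t) - c * t ^ (-ν)| ≤ C * t ^ (-(ν + δ))) {y : ℝ}
    (hy : 0 ≤ y) : |ζ.real {z | 1 < z * y} - c * y ^ ν| ≤ C * y ^ (ν + δ) := by
  rcases hy.eq_or_lt with rfl | hy
  · have h : ¬ ((1 : ℝ) < 0) := by norm_num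
    simp [Real.zero_rpow hν.ne', Real.zero_rpow (by positivity : ν + δ ≠ 0), h]
  · have := hexp y⁻¹ (inv_pos.2 hy)
    rw [Real.inv_rpow hy.le, Real.inv_rpow hy.le, Real.rpow_neg hy.le, Real.rpow_neg hy.le,
      inv_inv, inv_inv] at this
    convert this using 5
    ext z
    simp only [mem_ofPred_eq, mem_Ioi]
    rw [inv_lt_iff_one_lt_mul₀ hy, mul_comm]

variable [IsProbabilityMeasure τ]

theorem integrable_rpow_of_bounded {f : T → ℝ} (hf : Measurable f) {B a : ℝ}
    (hf0 : ∀ θ, 0 ≤ f θ) (hfB : ∀ θ, f θ ≤ B) (ha : 0 ≤ a) :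
    Integrable (fun θ => f θ ^ a) τ := by
  refine Integrable.of_bound (hf.pow_const a).aestronglyMeasurable (B ^ a)
    (ae_of_all _ fun θ => ?_)
  have := hf0 θ
  rw [Real.norm_of_nonneg (by positivity)]
  exact Real.rpow_le_rpow this (hfB θ) ha

variable [IsProbabilityMeasure ζ]

theorem measureReal_scaledTail_eq {V : T → ℝ} (hV : Measurable V) (hζ : ∀ᵐ z ∂ζ, 0 < z) {p : ℝ}
    (hp : 0 < p) : (ζ.prod τ).real (scaledTail V p) =
      1 - cdf ((ζ.prod τ).map fun q => q.1 * V q.2) p⁻¹ := by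
  have hm : Measurable fun q : ℝ × T => q.1 * V q.2 := by fun_prop
  have := Measure.isProbabilityMeasure_map (μ := ζ.prod τ) hm.aemeasurable
  rw [measureReal_congr (scaledTail_ae_eq hζ hp), cdf_eq_real,
    ← probReal_compl_eq_one_sub measurableSet_Iic, compl_Iic,
    map_measureReal_apply hm measurableSet_Ioi]

theorem continuousOn_measureReal_scaledTail {V : T → ℝ} (hV : Measurable V)
    (hζ : ∀ᵐ z ∂ζ, 0 < z) (hatom : ∀ v, τ {θ | V θ = v} = 0) :
    ContinuousOn (fun p => (ζ.prod τ).real (scaledTail V p)) (Ioi 0) := by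
  have hm : Measurable fun q : ℝ × T => q.1 * V q.2 := by fun_prop
  have := Measure.isProbabilityMeasure_map (μ := ζ.prod τ) hm.aemeasurable
  have := nullSingletons_map_mul hV hζ hatom
  refine ContinuousOn.congr ?_ fun p hp => measureReal_scaledTail_eq hV hζ hp
  refine continuousOn_const.sub ((continuous_cdf_of_nullSingletons _).comp_continuousOn ?_)
  exact continuousOn_inv₀.mono fun p hp => ne_of_gt hp

/-- The event that the transformed margin exceeds a high quantile is, up to a null set, a tail
event of the untransformed variable. -/
theorem marginal_event_ae_eq {V : T → ℝ} (hV : Measurable V) (hζ : ∀ᵐ z ∂ζ, 0 < z)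
    {s : ℝ → ℝ} (hs : Monotone s) {m : Measure ℝ} [IsProbabilityMeasure m] [NullSingletonClass m]
    (hm : m = (ζ.prod τ).map fun q => s (q.1 * V q.2)) {p : ℝ} (hp : 0 < p) :
    {q : ℝ × T | 1 - cdf m (s (q.1 * V q.2)) ≤ (ζ.prod τ).real (scaledTail V p)}
      =ᵐ[ζ.prod τ] scaledTail V p := by
  have hW : Measurable fun q : ℝ × T => q.1 * V q.2 := by fun_prop
  have hsW : Measurable fun q : ℝ × T => s (q.1 * V q.2) := hs.measurable.comp hW
  have := Measure.isProbabilityMeasure_map (μ := ζ.prod τ) hW.aemeasurable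
  set u := (ζ.prod τ).real (scaledTail V p) with hu
  have hSm : MeasurableSet {x | 1 - cdf m x ≤ u} :=
    measurableSet_le (measurable_const.sub (monotone_cdf m).measurable) measurable_const
  have hsub : scaledTail V p ⊆ {q : ℝ × T | 1 - cdf m (s (q.1 * V q.2)) ≤ u} := by
    intro q hq
    have h1 := lt_of_mem_scaledTail hp hq
    have h2 : cdf ((ζ.prod τ).map fun q => q.1 * V q.2) p⁻¹ ≤ cdf m (s (q.1 * V q.2)) := by
      rw [cdf_eq_real, cdf_eq_real, hm, map_measureReal_apply hW measurableSet_Iic,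
        map_measureReal_apply hsW measurableSet_Iic]
      refine measureReal_mono fun q' hq' => hs ?_
      have hq'' : q'.1 * V q'.2 ≤ p⁻¹ := hq'
      linarith
    have h3 := measureReal_scaledTail_eq (τ := τ) hV hζ hp
    simp only [mem_ofPred_eq]
    linarith
  -- The larger event has probability at most `u` by the integral transform, and `u` is the
  -- probability of the smaller one, so the inclusion is an equality up to a null set. No inverse of
  -- `s` is needed.
  symm
  refine ae_eq_of_subset_of_measure_ge hsub ?_ (measurableSet_scaledTail hV p).nullMeasurableSet
    (measure_ne_top _ _)
  refine (ENNReal.toReal_le_toReal (measure_ne_top _ _) (measure_ne_top _ _)).1 ?_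
  change (ζ.prod τ).real _ ≤ (ζ.prod τ).real _
  have h4 := measureReal_one_sub_cdf_le m (u := u) measureReal_nonneg
  have e : (ζ.prod τ).real {q : ℝ × T | 1 - cdf m (s (q.1 * V q.2)) ≤ u} =
      m.real {x | 1 - cdf m x ≤ u} := by
    conv_rhs => rw [hm]
    rw [map_measureReal_apply hsW (by rw [← hm]; exact hSm), ← hm]
    rfl
  rw [e]
  exact h4

theorem measureReal_prod_one_lt_mul {f : T → ℝ} (hf : Measurable f) :
    (ζ.prod τ).real {q | 1 < q.1 * f q.2} = ∫ θ, ζ.real {z | 1 < z * f θ} ∂τ := by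
  have hm : MeasurableSet {q : ℝ × T | 1 < q.1 * f q.2} :=
    measurableSet_lt measurable_const (by fun_prop)
  rw [measureReal_def, Measure.prod_apply_symm hm]
  refine (integral_toReal (measurable_measure_prodMk_right hm).aemeasurable ?_).symm
  exact ae_of_all _ fun θ => measure_lt_top _ _

/-- A product `Z f(Θ)` with bounded `f` inherits the tail expansion of `Z`. -/
theorem abs_measureReal_prod_sub_le {ν δ c C B : ℝ} (hν : 0 < ν) (hδ : 0 < δ) (hC : 0 < C)
    (hexp : ∀ t, 0 < t → |ζ.real (Ioi t) - c * t ^ (-ν)| ≤ C * t ^ (-(ν + δ)))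
    {f : T → ℝ} (hf : Measurable f) (hf0 : ∀ θ, 0 ≤ f θ) (hfB : ∀ θ, f θ ≤ B) :
    |(ζ.prod τ).real {q | 1 < q.1 * f q.2} - c * ∫ θ, f θ ^ ν ∂τ| ≤ C * B ^ (ν + δ) := by
  have hm : MeasurableSet {q : ℝ × T | 1 < q.1 * f q.2} :=
    measurableSet_lt measurable_const (by fun_prop)
  have hi1 : Integrable (fun θ => ζ.real {z | 1 < z * f θ}) τ := by
    refine Integrable.of_bound
      (measurable_measure_prodMk_right (μ := ζ) hm).ennreal_toReal.aestronglyMeasurable 1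
      (ae_of_all _ fun θ => ?_)
    rw [Real.norm_of_nonneg measureReal_nonneg]
    exact measureReal_le_one
  have hi2 := (integrable_rpow_of_bounded (τ := τ) hf hf0 hfB hν.le).const_mul c
  rw [measureReal_prod_one_lt_mul hf, ← integral_const_mul, ← integral_sub hi1 hi2]
  have := norm_integral_le_of_norm_le_const (μ := τ)
    (f := fun θ => ζ.real {z | 1 < z * f θ} - c * f θ ^ ν) (C := C * B ^ (ν + δ))
    (ae_of_all _ fun θ => by
      refine (abs_measureReal_one_lt_mul_sub_le hν hδ hexp (hf0 θ)).trans ?_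
      gcongr
      · exact hf0 θ
      · exact hfB θ)
  simpa using this

end Mixture

/-! ### The tail limit and the rate of convergence. -/

section Limit

variable {T : Type*} [MeasurableSpace T]

/-- The moment `E[V₊ ^ ν]`. -/
noncomputable def posMoment (τ : Measure T) (V : T → ℝ) (ν : ℝ) : ℝ := ∫ θ, max (V θ) 0 ^ ν ∂τ

/-- The tail limit `E[min (x V₊ ^ ν / E[V₊ ^ ν]) (y W₊ ^ ν / E[W₊ ^ ν])]` of a pair
`(Z V, Z W)`, where `Z` is independent of `(V, W)` and regularly varying with index `ν`. -/
noncomputable def productTailLimit (τ : Measure T) (V W : T → ℝ) (ν x y : ℝ) : ℝ :=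
  ∫ θ, min (x * (max (V θ) 0 ^ ν / posMoment τ V ν)) (y * (max (W θ) 0 ^ ν / posMoment τ W ν)) ∂τ

theorem posMoment_nonneg (τ : Measure T) (V : T → ℝ) (ν : ℝ) : 0 ≤ posMoment τ V ν :=
  integral_nonneg fun _ => by positivity

/-- Homogeneity allows the comparison to be made at levels `(t x, t y)` before dividing by `t`. -/
theorem productTailLimit_mul (τ : Measure T) (V W : T → ℝ) (ν : ℝ) {t : ℝ} (ht : 0 ≤ t)
    (x y : ℝ) :
    productTailLimit τ V W ν (t * x) (t * y) = t * productTailLimit τ V W ν x y := by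
  unfold productTailLimit
  rw [← integral_const_mul]
  simp_rw [mul_min_of_nonneg _ _ ht, mul_assoc]

theorem productTailLimit_zero_left (τ : Measure T) (V W : T → ℝ) (ν : ℝ) {y : ℝ} (hy : 0 ≤ y) :
    productTailLimit τ V W ν 0 y = 0 := by
  unfold productTailLimit
  refine (integral_congr_ae (ae_of_all _ fun θ => ?_)).trans (integral_zero T ℝ)
  simp only [zero_mul]
  exact min_eq_left (mul_nonneg hy (div_nonneg (by positivity) (posMoment_nonneg τ W ν)))

theorem productTailLimit_zero_right (τ : Measure T) (V W : T → ℝ) (ν : ℝ) {x : ℝ} (hx : 0 ≤ x) :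
    productTailLimit τ V W ν x 0 = 0 := by
  unfold productTailLimit
  refine (integral_congr_ae (ae_of_all _ fun θ => ?_)).trans (integral_zero T ℝ)
  simp only [zero_mul]
  exact min_eq_right (mul_nonneg hx (div_nonneg (by positivity) (posMoment_nonneg τ V ν)))

variable {τ : Measure T} [IsProbabilityMeasure τ] {ζ : Measure ℝ} [IsProbabilityMeasure ζ]

theorem integrable_posPart_rpow {V : T → ℝ} (hV : Measurable V) {M ν : ℝ} (hν : 0 ≤ ν)
    (hM : 0 ≤ M) (hVM : ∀ θ, V θ ≤ M) : Integrable (fun θ => max (V θ) 0 ^ ν) τ :=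
  integrable_rpow_of_bounded (hV.max measurable_const) (fun _ => le_max_right _ _)
    (fun θ => max_le (hVM θ) hM) hν

theorem posMoment_pos {V : T → ℝ} (hV : Measurable V) {M ν : ℝ} (hν : 0 < ν) (hM : 0 ≤ M)
    (hVM : ∀ θ, V θ ≤ M) (hpos : 0 < τ {θ | 0 < V θ}) : 0 < posMoment τ V ν := by
  unfold posMoment
  rw [integral_pos_iff_support_of_nonneg (fun _ => by positivity)
    (integrable_posPart_rpow hV hν.le hM hVM)]
  refine hpos.trans_le (measure_mono fun θ hθ => ?_)
  have h : 0 < max (V θ) 0 := lt_max_of_lt_left hθ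
  exact (Real.rpow_pos_of_pos h ν).ne'

/-- High quantiles of the margins: the tail event at level `u` is a tail event of `Z V` at a
level for which an expansion with remainder is available. -/
theorem exists_marginal_quantile {ν δ c C M : ℝ} (hν : 0 < ν) (hδ : 0 < δ) (hc : 0 < c)
    (hC : 0 < C) (hM : 0 < M)
    (hexp : ∀ t, 0 < t → |ζ.real (Ioi t) - c * t ^ (-ν)| ≤ C * t ^ (-(ν + δ)))
    (hζ : ∀ᵐ z ∂ζ, 0 < z) {V : T → ℝ} (hV : Measurable V) (hVM : ∀ θ, V θ ≤ M)
    (hatom : ∀ v, τ {θ | V θ = v} = 0) (hpos : 0 < τ {θ | 0 < V θ})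
    {s : ℝ → ℝ} (hs : Monotone s) {m : Measure ℝ} [IsProbabilityMeasure m] [NullSingletonClass m]
    (hm : m = (ζ.prod τ).map fun q => s (q.1 * V q.2)) :
    ∃ u₀ K, 0 < u₀ ∧ 0 < K ∧ ∀ u, 0 < u → u ≤ u₀ → ∃ p, 0 < p ∧
      {q : ℝ × T | 1 - cdf m (s (q.1 * V q.2)) ≤ u} =ᵐ[ζ.prod τ] scaledTail V p ∧
      |c * posMoment τ V ν * p ^ ν - u| ≤ K * u ^ (1 + δ / ν) ∧
      p ^ (ν + δ) ≤ K * u ^ (1 + δ / ν) := by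
  have hE := posMoment_pos hV hν hM.le hVM hpos
  obtain ⟨u₀, K, hu₀, hK, h⟩ := exists_inverse_expansion
    (G := fun p => (ζ.prod τ).real (scaledTail V p)) (κ := c * posMoment τ V ν)
    (C := C * M ^ (ν + δ)) (ν := ν) (δ := δ) (by positivity) (by positivity) hν hδ
    (continuousOn_measureReal_scaledTail hV hζ hatom) (by
      intro p hp
      have h1 := abs_measureReal_prod_sub_le (τ := τ) (B := p * M) hν hδ hC hexp
        (f := fun θ => p * max (V θ) 0) (by fun_prop) (fun θ => by positivity)
        (fun θ => by gcongr; exact max_le (hVM θ) hM.le)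
      have e : ∫ θ, (p * max (V θ) 0) ^ ν ∂τ = p ^ ν * posMoment τ V ν := by
        rw [posMoment, ← integral_const_mul]
        refine integral_congr_ae (ae_of_all _ fun θ => ?_)
        exact Real.mul_rpow hp.le (le_max_right _ _)
      rw [e, Real.mul_rpow hp.le hM.le] at h1
      calc _ = _ := by rw [mul_right_comm, mul_assoc]; rfl
        _ ≤ _ := h1
        _ = _ := by ring)
  refine ⟨u₀, K, hu₀, hK, fun u hu hu' => ?_⟩
  obtain ⟨p, hp, hpu, h1, h2⟩ := h u hu hu'
  refine ⟨p, hp, ?_, h1, h2⟩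
  rw [← hpu]
  exact marginal_event_ae_eq hV hζ hs hm hp

/-- The joint tail probability compared with the tail limit, in terms of the marginal levels. -/
theorem abs_joint_sub_productTailLimit_le {ν δ c C M : ℝ} (hν : 0 < ν) (hδ : 0 < δ) (hc : 0 < c)
    (hC : 0 < C) (hM : 0 < M)
    (hexp : ∀ t, 0 < t → |ζ.real (Ioi t) - c * t ^ (-ν)| ≤ C * t ^ (-(ν + δ)))
    (hζ : ∀ᵐ z ∂ζ, 0 < z) {V W : T → ℝ} (hV : Measurable V) (hW : Measurable W)
    (hVM : ∀ θ, V θ ≤ M) (hWM : ∀ θ, W θ ≤ M)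
    (hVpos : 0 < τ {θ | 0 < V θ}) (hWpos : 0 < τ {θ | 0 < W θ})
    {p p' u u' : ℝ} (hp : 0 < p) (hp' : 0 < p') :
    |(ζ.prod τ).real (scaledTail V p ∩ scaledTail W p') - productTailLimit τ V W ν u u'| ≤
      C * (p * M) ^ (ν + δ) + (|c * posMoment τ V ν * p ^ ν - u| +
        |c * posMoment τ W ν * p' ^ ν - u'|) := by
  have hE := posMoment_pos hV hν hM.le hVM hVpos
  have hE' := posMoment_pos hW hν hM.le hWM hWpos
  have hiV := integrable_posPart_rpow (τ := τ) hV hν.le hM.le hVM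
  have hiW := integrable_posPart_rpow (τ := τ) hW hν.le hM.le hWM
  rw [measureReal_congr (scaledTail_inter_ae_eq hζ p p')]
  have h1 := abs_measureReal_prod_sub_le (τ := τ) (B := p * M) hν hδ hC hexp
    (f := fun θ => min (p * max (V θ) 0) (p' * max (W θ) 0)) (by fun_prop)
    (fun θ => by positivity)
    (fun θ => (min_le_left _ _).trans (by gcongr; exact max_le (hVM θ) hM.le))
  refine (abs_sub_le _ _ _).trans (add_le_add h1 ?_)
  set v : T → ℝ := fun θ => max (V θ) 0 ^ ν with hv
  set w : T → ℝ := fun θ => max (W θ) 0 ^ ν with hw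
  have hv0 : ∀ θ, 0 ≤ v θ := fun θ => by positivity
  have hw0 : ∀ θ, 0 ≤ w θ := fun θ => by positivity
  have e : ∀ θ, min (p * max (V θ) 0) (p' * max (W θ) 0) ^ ν = min (p ^ ν * v θ) (p' ^ ν * w θ) := by
    intro θ
    rw [hv, hw, ← Real.mul_rpow hp.le (le_max_right _ _), ← Real.mul_rpow hp'.le (le_max_right _ _)]
    have hmono : MonotoneOn (fun x : ℝ => x ^ ν) (Ici 0) := fun a ha b _ hab =>
      Real.rpow_le_rpow ha hab hν.le
    exact hmono.map_min (mem_Ici.2 (by positivity)) (mem_Ici.2 (by positivity))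
  simp_rw [e]
  have hi1 : Integrable (fun θ => c * min (p ^ ν * v θ) (p' ^ ν * w θ)) τ :=
    ((hiV.const_mul _).inf (hiW.const_mul _)).const_mul _
  have hi2 : Integrable (fun θ => min (u * (v θ / posMoment τ V ν))
      (u' * (w θ / posMoment τ W ν))) τ :=
    ((hiV.div_const _).const_mul _).inf ((hiW.div_const _).const_mul _)
  have hi3 : Integrable (fun θ => |c * posMoment τ V ν * p ^ ν - u| / posMoment τ V ν * v θ +
      |c * posMoment τ W ν * p' ^ ν - u'| / posMoment τ W ν * w θ) τ :=
    (hiV.const_mul _).add (hiW.const_mul _)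
  -- For exact quantiles `c * E * a = b` and the two arguments of the minima coincide; in general
  -- the discrepancy is proportional to `k / E`, whose integral is `1` when `E` is the moment of
  -- `k`.
  have habs : ∀ E a b k : ℝ, 0 < E → 0 ≤ k →
      |c * (a * k) - b * (k / E)| = |c * E * a - b| / E * k := by
    intro E a b k hE hk
    have h : c * (a * k) - b * (k / E) = (c * E * a - b) / E * k := by field_simp
    rw [h, abs_mul, abs_div, abs_of_pos hE, abs_of_nonneg hk]
  unfold productTailLimit
  rw [← integral_const_mul, ← integral_sub hi1 hi2]
  have hb := norm_integral_le_of_norm_le hi3 (ae_of_all τ fun θ => show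
      ‖c * min (p ^ ν * v θ) (p' ^ ν * w θ) -
        min (u * (v θ / posMoment τ V ν)) (u' * (w θ / posMoment τ W ν))‖ ≤ _ by
    rw [mul_min_of_nonneg _ _ hc.le]
    refine (abs_min_sub_min_le_max _ _ _ _).trans ((max_le_add_of_nonneg (abs_nonneg _)
      (abs_nonneg _)).trans_eq ?_)
    congr 1
    · exact habs _ _ _ _ hE (hv0 θ)
    · exact habs _ _ _ _ hE' (hw0 θ))
  refine hb.trans_eq ?_
  rw [integral_add (hiV.const_mul _) (hiW.const_mul _), integral_const_mul, integral_const_mul]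
  change _ * posMoment τ V ν + _ * posMoment τ W ν = _
  rw [div_mul_cancel₀ _ hE.ne', div_mul_cancel₀ _ hE'.ne']

/-- The tail ratio of `(s (Z V), r (Z W))` converges to `productTailLimit` at a polynomial
rate. -/
theorem exists_abs_tailRatio_sub_le {ν α c C M : ℝ} (hν : 0 < ν) (hα : 0 < α) (hc : 0 < c)
    (hC : 0 < C) (hM : 0 < M)
    (hexp : ∀ t, 0 < t → |ζ.real (Ioi t) - c * t ^ (-ν)| ≤ C * t ^ (-(ν + α * ν)))
    (hζ : ∀ᵐ z ∂ζ, 0 < z) {V W : T → ℝ} (hV : Measurable V) (hW : Measurable W)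
    (hVM : ∀ θ, V θ ≤ M) (hWM : ∀ θ, W θ ≤ M)
    (hVatom : ∀ v, τ {θ | V θ = v} = 0) (hWatom : ∀ v, τ {θ | W θ = v} = 0)
    (hVpos : 0 < τ {θ | 0 < V θ}) (hWpos : 0 < τ {θ | 0 < W θ})
    {s r : ℝ → ℝ} (hs : Monotone s) (hr : Monotone r)
    {F : Measure (ℝ × ℝ)} [IsProbabilityMeasure F]
    [NullSingletonClass F.fst] [NullSingletonClass F.snd]
    (hF : F = (ζ.prod τ).map fun q => (s (q.1 * V q.2), r (q.1 * W q.2))) :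
    ∃ u₀ K, 0 < u₀ ∧ 0 < K ∧ ∀ t x y, 0 < t → 0 ≤ x → 0 ≤ y → t * x ≤ u₀ → t * y ≤ u₀ →
      |tailRatio F t x y - productTailLimit τ V W ν x y| ≤
        K * (x ^ (1 + α) + y ^ (1 + α)) * t ^ α := by
  have hαν : 0 < α * ν := by positivity
  have hsm : Measurable fun q : ℝ × T => s (q.1 * V q.2) := hs.measurable.comp (by fun_prop)
  have hrm : Measurable fun q : ℝ × T => r (q.1 * W q.2) := hr.measurable.comp (by fun_prop)
  have hF1 : F.fst = (ζ.prod τ).map fun q => s (q.1 * V q.2) := by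
    conv_lhs => rw [hF]
    exact Measure.fst_map_prodMk hrm
  have hF2 : F.snd = (ζ.prod τ).map fun q => r (q.1 * W q.2) := by
    conv_lhs => rw [hF]
    exact Measure.snd_map_prodMk hsm
  obtain ⟨u₁, K₁, hu₁, hK₁, h₁⟩ := exists_marginal_quantile (τ := τ) hν hαν hc hC hM hexp hζ hV
    hVM hVatom hVpos hs hF1
  obtain ⟨u₂, K₂, hu₂, hK₂, h₂⟩ := exists_marginal_quantile (τ := τ) hν hαν hc hC hM hexp hζ hW
    hWM hWatom hWpos hr hF2
  -- The choice `δ = α * ν` turns the exponent `1 + δ / ν` into `1 + α`.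
  rw [mul_div_cancel_right₀ _ hν.ne'] at h₁ h₂
  set K := C * M ^ (ν + α * ν) * K₁ + K₁ + K₂ with hK
  have hK0 : 0 < K := by positivity
  have m1 : ∀ u, MeasurableSet {a | 1 - cdf F.fst a ≤ u} := fun u =>
    measurableSet_le (measurable_const.sub (monotone_cdf _).measurable) measurable_const
  have m2 : ∀ u, MeasurableSet {a | 1 - cdf F.snd a ≤ u} := fun u =>
    measurableSet_le (measurable_const.sub (monotone_cdf _).measurable) measurable_const
  refine ⟨min u₁ u₂, K, by positivity, hK0, fun t x y ht hx hy htx hty => ?_⟩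
  have hnn : 0 ≤ K * (x ^ (1 + α) + y ^ (1 + α)) * t ^ α := by positivity
  -- Quantiles are available only at positive levels; on the axes both the tail ratio and the limit
  -- are zero.
  rcases hx.eq_or_lt with rfl | hx
  · rw [productTailLimit_zero_left τ V W ν hy]
    have h0 : F.real {p : ℝ × ℝ | 1 - cdf F.fst p.1 ≤ t * 0 ∧ 1 - cdf F.snd p.2 ≤ t * y} = 0 := by
      refine le_antisymm ?_ measureReal_nonneg
      have h := measureReal_one_sub_cdf_le F.fst (u := t * 0) (by simp)
      have e : F.fst.real {a | 1 - cdf F.fst a ≤ t * 0} =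
          F.real (Prod.fst ⁻¹' {a | 1 - cdf F.fst a ≤ t * 0}) :=
        map_measureReal_apply measurable_fst (m1 _)
      rw [e] at h
      refine (measureReal_mono fun q hq => ?_).trans (h.trans (by simp))
      exact hq.1
    rw [tailRatio, h0]
    simpa using hnn
  rcases hy.eq_or_lt with rfl | hy
  · rw [productTailLimit_zero_right τ V W ν hx.le]
    have h0 : F.real {p : ℝ × ℝ | 1 - cdf F.fst p.1 ≤ t * x ∧ 1 - cdf F.snd p.2 ≤ t * 0} = 0 := by
      refine le_antisymm ?_ measureReal_nonneg
      have h := measureReal_one_sub_cdf_le F.snd (u := t * 0) (by simp)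
      have e : F.snd.real {a | 1 - cdf F.snd a ≤ t * 0} =
          F.real (Prod.snd ⁻¹' {a | 1 - cdf F.snd a ≤ t * 0}) :=
        map_measureReal_apply measurable_snd (m2 _)
      rw [e] at h
      refine (measureReal_mono fun q hq => ?_).trans (h.trans (by simp))
      exact hq.2
    rw [tailRatio, h0]
    simpa using hnn
  obtain ⟨p, hp, hpe, hp1, hp2⟩ := h₁ (t * x) (by positivity) (htx.trans (min_le_left _ _))
  obtain ⟨p', hp', hpe', hp1', -⟩ := h₂ (t * y) (by positivity) (hty.trans (min_le_right _ _))
  have hJ : F.real {a : ℝ × ℝ | 1 - cdf F.fst a.1 ≤ t * x ∧ 1 - cdf F.snd a.2 ≤ t * y} =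
      (ζ.prod τ).real (scaledTail V p ∩ scaledTail W p') := by
    rw [← measureReal_congr (hpe.inter hpe')]
    have hS : MeasurableSet {a : ℝ × ℝ | 1 - cdf F.fst a.1 ≤ t * x ∧ 1 - cdf F.snd a.2 ≤ t * y} :=
      (measurable_fst (m1 (t * x))).inter (measurable_snd (m2 (t * y)))
    -- The marginal distribution functions are made opaque so that `hF` rewrites only the measure.
    generalize cdf F.fst = G₁ at hS ⊢
    generalize cdf F.snd = G₂ at hS ⊢
    rw [hF, map_measureReal_apply (hsm.prodMk hrm) hS]
    rfl
  have key := abs_joint_sub_productTailLimit_le (τ := τ) hν hαν hc hC hM hexp hζ hV hW hVM hWM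
    hVpos hWpos (u := t * x) (u' := t * y) hp hp'
  rw [productTailLimit_mul τ V W ν ht.le] at key
  have hre : tailRatio F t x y - productTailLimit τ V W ν x y =
      t⁻¹ * ((ζ.prod τ).real (scaledTail V p ∩ scaledTail W p') -
        t * productTailLimit τ V W ν x y) := by
    rw [tailRatio, hJ]
    field_simp
  rw [hre, abs_mul, abs_of_pos (inv_pos.2 ht), inv_mul_le_iff₀ ht]
  refine key.trans ?_
  have ex : (t * x) ^ (1 + α) = t * t ^ α * x ^ (1 + α) := by
    rw [Real.mul_rpow ht.le hx.le, Real.rpow_add ht, Real.rpow_one]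
  have ey : (t * y) ^ (1 + α) = t * t ^ α * y ^ (1 + α) := by
    rw [Real.mul_rpow ht.le hy.le, Real.rpow_add ht, Real.rpow_one]
  have b1 : C * (p * M) ^ (ν + α * ν) ≤ C * M ^ (ν + α * ν) * K₁ * (t * x) ^ (1 + α) := by
    rw [Real.mul_rpow hp.le hM.le]
    calc _ = C * M ^ (ν + α * ν) * p ^ (ν + α * ν) := by ring
      _ ≤ C * M ^ (ν + α * ν) * (K₁ * (t * x) ^ (1 + α)) := by gcongr
      _ = _ := by ring
  have px : 0 ≤ (t * x) ^ (1 + α) := by positivity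
  have py : 0 ≤ (t * y) ^ (1 + α) := by positivity
  have c1 : 0 ≤ C * M ^ (ν + α * ν) * K₁ := by positivity
  calc _ ≤ C * M ^ (ν + α * ν) * K₁ * (t * x) ^ (1 + α) +
        (K₁ * (t * x) ^ (1 + α) + K₂ * (t * y) ^ (1 + α)) := by gcongr
    _ ≤ K * (t * x) ^ (1 + α) + K * (t * y) ^ (1 + α) := by
        rw [hK]; nlinarith [mul_nonneg c1 py, mul_nonneg hK₁.le py, mul_nonneg hK₂.le px]
    _ = _ := by rw [ex, ey]; ring

end Limit

/-! ### Linear forms on the unit circle. -/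

section Circle

/-- The uniform law on the angles `(0, 2π]`. -/
noncomputable def uniformAngle : Measure ℝ :=
  ProbabilityTheory.cond (volume : Measure ℝ) (Ioc 0 (2 * Real.pi))

instance isProbabilityMeasure_uniformAngle : IsProbabilityMeasure uniformAngle :=
  cond_isProbabilityMeasure_of_finite (by simp [Real.pi_pos]) measure_Ioc_lt_top.ne

theorem uniformAngle_absolutelyContinuous : uniformAngle ≪ volume := cond_absolutelyContinuous

/-- A nonzero linear form takes each value on the circle at countably many angles at most. -/
theorem countable_setOf_linear_cos_sin_eq {a b : ℝ} (hab : a ≠ 0 ∨ b ≠ 0) (v : ℝ) :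
    {θ : ℝ | a * Real.cos θ + b * Real.sin θ = v}.Countable := by
  set w : ℂ := ⟨a, b⟩ with hw
  have hw0 : w ≠ 0 := by
    intro h
    have h1 := congrArg Complex.re h
    have h2 := congrArg Complex.im h
    simp only [hw, Complex.zero_re, Complex.zero_im] at h1 h2
    tauto
  have hn : ‖w‖ ≠ 0 := norm_ne_zero_iff.2 hw0
  have ea : a = ‖w‖ * Real.cos w.arg := (Complex.norm_mul_cos_arg w).symm
  have eb : b = ‖w‖ * Real.sin w.arg := (Complex.norm_mul_sin_arg w).symm
  -- Amplitude-phase form: the level sets become those of a shifted cosine.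
  have hV : ∀ θ, a * Real.cos θ + b * Real.sin θ = ‖w‖ * Real.cos (θ - w.arg) := by
    intro θ
    conv_lhs => rw [ea, eb]
    rw [Real.cos_sub]; ring
  rcases {θ : ℝ | a * Real.cos θ + b * Real.sin θ = v}.eq_empty_or_nonempty with he | ⟨θ₀, h₀⟩
  · rw [he]; exact countable_empty
  refine ((countable_range fun k : ℤ => 2 * (k : ℝ) * Real.pi + (θ₀ - w.arg) + w.arg).union
    (countable_range fun k : ℤ => 2 * (k : ℝ) * Real.pi - (θ₀ - w.arg) + w.arg)).mono ?_
  intro θ hθ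
  have h1 : a * Real.cos θ + b * Real.sin θ = v := hθ
  have h2 : a * Real.cos θ₀ + b * Real.sin θ₀ = v := h₀
  rw [← h2, hV, hV] at h1
  obtain ⟨k, hk | hk⟩ := Real.cos_eq_cos_iff.1 (mul_left_cancel₀ hn h1).symm
  · left; exact ⟨k, by dsimp only; linarith⟩
  · right; exact ⟨k, by dsimp only; linarith⟩

theorem uniformAngle_setOf_linear_eq {a b : ℝ} (hab : a ≠ 0 ∨ b ≠ 0) (v : ℝ) :
    uniformAngle {θ | a * Real.cos θ + b * Real.sin θ = v} = 0 :=
  uniformAngle_absolutelyContinuous ((countable_setOf_linear_cos_sin_eq hab v).measure_zero _)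

/-- The form has mean zero and vanishes only on a null set, so it cannot be nonpositive almost
everywhere. -/
theorem uniformAngle_setOf_linear_pos {a b : ℝ} (hab : a ≠ 0 ∨ b ≠ 0) :
    0 < uniformAngle {θ | 0 < a * Real.cos θ + b * Real.sin θ} := by
  rw [pos_iff_ne_zero]
  intro h
  have hneg : ∀ᵐ θ ∂uniformAngle, 0 < -(a * Real.cos θ + b * Real.sin θ) := by
    have h1 : ∀ᵐ θ ∂uniformAngle, ¬ 0 < a * Real.cos θ + b * Real.sin θ := by
      rw [ae_iff]; simpa only [not_not] using h
    have h2 : ∀ᵐ θ ∂uniformAngle, ¬ a * Real.cos θ + b * Real.sin θ = 0 := by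
      rw [ae_iff]; simpa only [not_not] using uniformAngle_setOf_linear_eq hab 0
    filter_upwards [h1, h2] with θ h1 h2
    have := lt_of_le_of_ne (not_lt.1 h1) h2
    linarith
  have hzero : ∫ θ, -(a * Real.cos θ + b * Real.sin θ) ∂uniformAngle = 0 := by
    rw [uniformAngle, ProbabilityTheory.cond, integral_smul_measure,
      ← intervalIntegral.integral_of_le (by positivity), intervalIntegral.integral_neg,
      intervalIntegral.integral_add, intervalIntegral.integral_const_mul,
      intervalIntegral.integral_const_mul, integral_cos, integral_sin]
    · simp
    · exact (by fun_prop : Continuous fun θ => a * Real.cos θ).intervalIntegrable _ _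
    · exact (by fun_prop : Continuous fun θ => b * Real.sin θ).intervalIntegrable _ _
  have hi : Integrable (fun θ => -(a * Real.cos θ + b * Real.sin θ)) uniformAngle := by
    refine Integrable.of_bound (by fun_prop) (|a| + |b|) (ae_of_all _ fun θ => ?_)
    rw [norm_neg]
    refine (norm_add_le _ _).trans (add_le_add ?_ ?_)
    · rw [Real.norm_eq_abs, abs_mul]
      exact mul_le_of_le_one_right (abs_nonneg _) (Real.abs_cos_le_one θ)
    · rw [Real.norm_eq_abs, abs_mul]
      exact mul_le_of_le_one_right (abs_nonneg _) (Real.abs_sin_le_one θ)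
  rw [integral_eq_zero_iff_of_nonneg_ae (hneg.mono fun θ h => h.le) hi] at hzero
  have hF : ∀ᵐ θ ∂uniformAngle, False := by
    filter_upwards [hneg, hzero] with θ h1 h2
    rw [Pi.zero_apply] at h2
    linarith
  exact IsProbabilityMeasure.ne_zero uniformAngle (by simpa using hF)

end Circle

/-! ### Polar form of the law and assembly. -/

/-- The law of a meta-elliptical vector in terms of the radius and the angle. -/
theorem map_ellipticalLaw_eq (ζ : Measure ℝ) [IsProbabilityMeasure ζ] (m : Fin 2 → ℝ)
    (A : Matrix (Fin 2) (Fin 2) ℝ) {s r : ℝ → ℝ} (hs : Monotone s) (hr : Monotone r) :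
    (ellipticalLaw ζ m A).map (fun w => (s (w 0), r (w 1))) =
      (ζ.prod uniformAngle).map fun q =>
        (s (m 0 + q.1 * (A 0 0 * Real.cos q.2 + A 0 1 * Real.sin q.2)),
          r (m 1 + q.1 * (A 1 0 * Real.cos q.2 + A 1 1 * Real.sin q.2))) := by
  have hu : Measurable fun θ : ℝ => ![Real.cos θ, Real.sin θ] := by
    refine measurable_pi_iff.2 fun i => ?_
    fin_cases i
    · exact Real.measurable_cos
    · exact Real.measurable_sin
  have hA : Measurable fun p : ℝ × (Fin 2 → ℝ) => m + p.1 • A.mulVec p.2 := by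
    refine Continuous.measurable ?_
    fun_prop
  have hsr : Measurable fun w : Fin 2 → ℝ => (s (w 0), r (w 1)) :=
    (hs.measurable.comp (measurable_pi_apply 0)).prodMk (hr.measurable.comp (measurable_pi_apply 1))
  have hc : uniformCircle = uniformAngle.map fun θ => ![Real.cos θ, Real.sin θ] := rfl
  have hp : ζ.prod uniformCircle =
      (ζ.prod uniformAngle).map (Prod.map id fun θ : ℝ => ![Real.cos θ, Real.sin θ]) := by
    rw [hc, ← Measure.map_prod_map ζ uniformAngle measurable_id hu, Measure.map_id]
  rw [ellipticalLaw, hp, Measure.map_map hsr hA,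
    Measure.map_map (hsr.comp hA) (measurable_id.prodMap hu)]
  congr 1
  ext q <;> simp [Matrix.vecHead, Matrix.vecTail]

/-- Full rank of `A Aᵀ` makes `A` invertible, so each coordinate is a nonzero linear form on the
circle. -/
theorem row_ne_zero_of_det_mul_transpose_ne_zero {A : Matrix (Fin 2) (Fin 2) ℝ}
    (h : (A * A.transpose).det ≠ 0) (i : Fin 2) : A i 0 ≠ 0 ∨ A i 1 ≠ 0 := by
  rw [Matrix.det_mul, Matrix.det_transpose, Matrix.det_fin_two] at h
  by_contra! hcon
  apply h
  fin_cases i <;> simp_all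

theorem lemma6p1 {Ω : Type*} [MeasurableSpace Ω] (P : Measure Ω) [IsProbabilityMeasure P]
    (Z : Ω → ℝ) (hZm : AEMeasurable Z P) (hZpos : ∀ᵐ ω ∂P, 0 < Z ω)
    (F : Measure (ℝ × ℝ)) [IsProbabilityMeasure F]
    (hFcont : Continuous fun p : ℝ × ℝ => F.real (Iic p))
    (hF : IsParallelMetaElliptical F (P.map Z))
    (ν β : ℝ) (hν : 0 < ν) (hβ : β < 0)
    (A : ℝ → ℝ) (hA : Tendsto A atTop (𝓝 0))
    (hAsign : (∀ᶠ t in atTop, 0 < A t) ∨ (∀ᶠ t in atTop, A t < 0))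
    (hZ : ∀ x : ℝ, 0 < x →
      Tendsto (fun t : ℝ =>
          (P.real {ω | t * x < Z ω} / P.real {ω | t < Z ω} - x ^ (-ν)) / A t)
        atTop (𝓝 (x ^ (-ν) * ((x ^ β - 1) / β)))) :
    ∃ R : ℝ → ℝ → ℝ, IsTailLimit F R ∧
      ∀ α : ℝ, 0 < α → α < -β / ν → SecondOrderCondition F R α := by
  have hA0 : ∀ᶠ t in atTop, A t ≠ 0 :=
    hAsign.elim (fun h => h.mono fun t ht => ht.ne') (fun h => h.mono fun t ht => ht.ne)
  have hprob := Measure.isProbabilityMeasure_map hZm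
  have hζ : ∀ᵐ z ∂(P.map Z), 0 < z := (ae_map_iff hZm measurableSet_Ioi).2 hZpos
  have hH : ∀ t, P.real {ω | t < Z ω} = (P.map Z).real (Ioi t) := fun t => by
    rw [measureReal_def, measureReal_def, Measure.map_apply_of_aemeasurable hZm measurableSet_Ioi]
    rfl
  simp_rw [hH] at hZ
  obtain ⟨_, ⟨m, B, hdet, -, rfl⟩, s, r, hs, hr, hFeq⟩ := hF
  rw [map_ellipticalLaw_eq (P.map Z) m B hs hr] at hFeq
  have := nullSingletons_fst_of_continuous hFcont
  have := nullSingletons_snd_of_continuous hFcont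
  set V : Fin 2 → ℝ → ℝ := fun i θ => B i 0 * Real.cos θ + B i 1 * Real.sin θ with hVdef
  have hVm : ∀ i, Measurable (V i) := fun i => by simp only [hVdef]; fun_prop
  have hrow := row_ne_zero_of_det_mul_transpose_ne_zero hdet
  set M : ℝ := 1 + ∑ i, (|B i 0| + |B i 1|) with hMdef
  have hM : 0 < M := by positivity
  have hVM : ∀ i θ, V i θ ≤ M := by
    intro i θ
    have h1 : B i 0 * Real.cos θ ≤ |B i 0| := (le_abs_self _).trans (by
      rw [abs_mul]; exact mul_le_of_le_one_right (abs_nonneg _) (Real.abs_cos_le_one θ))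
    have h2 : B i 1 * Real.sin θ ≤ |B i 1| := (le_abs_self _).trans (by
      rw [abs_mul]; exact mul_le_of_le_one_right (abs_nonneg _) (Real.abs_sin_le_one θ))
    have h3 := Finset.single_le_sum (f := fun i => |B i 0| + |B i 1|)
      (fun i _ => by positivity) (Finset.mem_univ i)
    simp only [hVdef, hMdef]
    linarith
  -- The Pareto constants may depend on `α`, but the limit function does not, so one `R` serves all
  -- exponents.
  have hrate : ∀ α : ℝ, 0 < α → α < -β / ν → ∃ u₀ K, 0 < u₀ ∧ 0 < K ∧ ∀ t x y, 0 < t → 0 ≤ x →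
      0 ≤ y → t * x ≤ u₀ → t * y ≤ u₀ →
      |tailRatio F t x y - productTailLimit uniformAngle (V 0) (V 1) ν x y| ≤
        K * (x ^ (1 + α) + y ^ (1 + α)) * t ^ α := by
    intro α hα hαβ
    rw [lt_div_iff₀ hν] at hαβ
    obtain ⟨c, C, hc, hC, hexp⟩ := exists_pareto_expansion (H := fun t => (P.map Z).real (Ioi t))
      hν hβ (by positivity : 0 < α * ν) hαβ (fun _ => measureReal_nonneg)
      (fun _ => measureReal_le_one) hA hA0 hZ
    exact exists_abs_tailRatio_sub_le hν hα hc hC hM hexp hζ (hVm 0) (hVm 1) (hVM 0) (hVM 1)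
      (uniformAngle_setOf_linear_eq (hrow 0)) (uniformAngle_setOf_linear_eq (hrow 1))
      (uniformAngle_setOf_linear_pos (hrow 0)) (uniformAngle_setOf_linear_pos (hrow 1))
      -- The location `m` is absorbed into the monotone transformations.
      (s := fun a => s (m 0 + a)) (r := fun a => r (m 1 + a))
      (fun a b h => hs (by linarith)) (fun a b h => hr (by linarith)) hFeq
  have hsmall : ∀ x u₀ : ℝ, 0 < u₀ → ∀ᶠ t in 𝓝[>] (0 : ℝ), t * x ≤ u₀ := by
    intro x u₀ hu₀
    have : Tendsto (fun t : ℝ => t * x) (𝓝[>] 0) (𝓝 (0 * x)) :=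
      (tendsto_id.mul_const x).mono_left nhdsWithin_le_nhds
    rw [zero_mul] at this
    exact this.eventually_le_const hu₀
  refine ⟨productTailLimit uniformAngle (V 0) (V 1) ν, fun x y hx hy => ?_, fun α hα hαβ => ?_⟩
  · have hβν : 0 < -β / ν := div_pos (by linarith) hν
    -- Any admissible exponent gives pointwise convergence; the midpoint of the range is taken.
    obtain ⟨u₀, K, hu₀, hK, h⟩ := hrate (-β / ν / 2) (by linarith) (by linarith)
    rw [tendsto_iff_norm_sub_tendsto_zero]
    have hlim : Tendsto (fun t : ℝ => K * (x ^ (1 + -β / ν / 2) + y ^ (1 + -β / ν / 2)) *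
        t ^ (-β / ν / 2)) (𝓝[>] 0) (𝓝 0) := by
      have h1 := (Real.continuousAt_rpow_const 0 (-β / ν / 2) (Or.inr (by linarith))).tendsto
      rw [Real.zero_rpow (by linarith)] at h1
      simpa using (h1.mono_left nhdsWithin_le_nhds).const_mul
        (K * (x ^ (1 + -β / ν / 2) + y ^ (1 + -β / ν / 2)))
    refine squeeze_zero' (Eventually.of_forall fun _ => norm_nonneg _) ?_ hlim
    filter_upwards [hsmall x u₀ hu₀, hsmall y u₀ hu₀, self_mem_nhdsWithin] with t h1 h2 h3
    exact h t x y h3 hx hy h1 h2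
  · obtain ⟨u₀, K, hu₀, hK, h⟩ := hrate α hα hαβ
    refine ⟨K * (1 + 1), ?_⟩
    filter_upwards [hsmall 1 u₀ hu₀, self_mem_nhdsWithin] with t h1 h3 x y hx hy hxy
    have ht : 0 < t := h3
    rw [mul_one] at h1
    have hx1 : x ≤ 1 := by linarith
    have hy1 : y ≤ 1 := by linarith
    refine (h t x y ht hx hy (by nlinarith) (by nlinarith)).trans ?_
    gcongr
    · exact Real.rpow_le_one hx hx1 (by positivity)
    · exact Real.rpow_le_one hy hy1 (by positivity)
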